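/- A loop is a set with a multiplication for which all left and right translations are bijections and which has a two-sided neutral element $1$; write $x\backslash y$, $y/x$ for the two divisions. A subloop of a loop $Q$ is normal if it is the kernel of a loop homomorphism; a normal subloop $A$ corresponds to the congruence $x\sim_A y \iff x/y\in A$. For congruences $\alpha,\beta,\delta$ of $Q$, $\alpha$ centralizes $\beta$ modulo $\delta$ if for all loop terms $t$ and all tuples with $a_i\mathrel{\alpha}b_i$ and $u_j\mathrel{\beta}v_j$, $t(a,u)\mathrel{\delta}t(a,v)$ implies $t(b,u)\mathrel{\delta}t(b,v)$; the commutator $[\alpha,\beta]$ is the smallest $\delta$ with this property, and for normal subloops $[A,B]_Q$ is the class of $1$ of $[\sim_A,\sim_B]$. A normal subloop $A$ is abelian in $Q$ if $[A,A]_Q=1$. The loop $Q$ is congruence solvable if there is a series $1=A_0\le A_1\le\cdots\le A_n=Q$ of normal subloops of $Q$ such that $A_{i+1}/A_i$ is abelian in $Q/A_i$ for every $i<n$. Let $A$ be a commutative group and $F$ a loop. Given maps $\varphi,\psi:F\times F\to\mathrm{Aut}(A)$ and $\theta:F\times F\to A$, consider on $A\times F$ the multiplication $$(a,x)(b,y)=(\varphi_{x,y}(a)+\psi_{x,y}(b)+\theta_{x,y},\,xy).$$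 If $\varphi_{y,1}=\mathrm{id}=\psi_{1,y}$ and $\theta_{1,y}=0=\theta_{y,1}$ for all $y\in F$, this is a loop, called an abelian extension of $A$ by $F$. If, without these normalizations, it is a loop, it is called an affine quasidirect product of $A$ and $F$. The class of iterated abelian extensions (respectively, of polyabelian loops) is the smallest class of loops that is closed under isomorphism, contains all commutative groups, and contains every abelian extension (respectively, affine quasidirect product) of a commutative group by (respectively, and) a member of the class. Corollary 4.1. A loop $Q$ is congruence solvable if and only if it is an iterated abelian extension, and $Q$ is an iterated abelian extension if and only if it is polyabelian. -/

import Mathlib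

universe u v

namespace LoopTheory

/-- A loop: a quasigroup (all left and right translations are bijective, with inverses
`ldiv x` and `(· / x)`) with a two-sided neutral element `1`. -/
class Loop (Q : Type u) extends MulOneClass Q, Div Q where
  /-- Left division. -/
  ldiv : Q → Q → Q
  mul_ldiv : ∀ x y : Q, x * ldiv x y = y
  ldiv_mul : ∀ x y : Q, ldiv x (x * y) = y
  rdiv_mul : ∀ x y : Q, (y / x) * x = y
  mul_rdiv : ∀ x y : Q, (y * x) / x = y

open Loop

/-- The loop `Q` is a commutative group. -/
def IsAbelianGroup (Q : Type u) [Loop Q] : Prop :=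
  (∀ x y z : Q, (x * y) * z = x * (y * z)) ∧ ∀ x y : Q, x * y = y * x

section Basic

variable {Q : Type u} [Loop Q]

theorem eq_of_mul_right_eq {x y z : Q} (h : y * x = z * x) : y = z := by
  rw [← mul_rdiv x y, h, mul_rdiv]

theorem eq_of_mul_left_eq {x y z : Q} (h : x * y = x * z) : y = z := by
  rw [← ldiv_mul x y, h, ldiv_mul]

theorem rdiv_eq_one {x y : Q} : x / y = 1 ↔ x = y := by
  constructor
  · intro h
    have := rdiv_mul y x
    rw [h, one_mul] at this
    exact this.symm
  · rintro rfl
    apply eq_of_mul_right_eq (x := x)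
    rw [rdiv_mul, one_mul]

theorem map_ldiv {L : Type v} [Loop L] (f : Q →* L) (x y : Q) :
    f (ldiv x y) = ldiv (f x) (f y) := by
  apply eq_of_mul_left_eq (x := f x)
  rw [mul_ldiv, ← map_mul, mul_ldiv]

theorem map_rdiv {L : Type v} [Loop L] (f : Q →* L) (x y : Q) :
    f (x / y) = f x / f y := by
  apply eq_of_mul_right_eq (x := f y)
  rw [rdiv_mul, ← map_mul, rdiv_mul]

end Basic

/-! ### Congruences and quotients -/

/-- A congruence of a loop: an equivalence relation compatible with `*`, `\` and `/`. -/
structure LoopCon (Q : Type u) [Loop Q] extends Setoid Q where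
  mul' : ∀ {w x y z : Q}, r w x → r y z → r (w * y) (x * z)
  ldiv' : ∀ {w x y z : Q}, r w x → r y z → r (ldiv w y) (ldiv x z)
  div' : ∀ {w x y z : Q}, r w x → r y z → r (w / y) (x / z)

namespace LoopCon

variable {Q : Type u} [Loop Q]

/-- The quotient of a loop by a congruence. -/
def Quot (c : LoopCon Q) : Type u := Quotient c.toSetoid

instance (c : LoopCon Q) : Loop c.Quot where
  one := Quotient.mk c.toSetoid 1
  mul := Quotient.map₂ (· * ·) fun _ _ h _ _ k => c.mul' h k
  div := Quotient.map₂ (· / ·) fun _ _ h _ _ k => c.div' h k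
  ldiv := Quotient.map₂ ldiv fun _ _ h _ _ k => c.ldiv' h k
  one_mul := by
    rintro ⟨x⟩
    exact congrArg (Quotient.mk c.toSetoid) (one_mul x)
  mul_one := by
    rintro ⟨x⟩
    exact congrArg (Quotient.mk c.toSetoid) (mul_one x)
  mul_ldiv := by
    rintro ⟨x⟩ ⟨y⟩
    exact congrArg (Quotient.mk c.toSetoid) (mul_ldiv x y)
  ldiv_mul := by
    rintro ⟨x⟩ ⟨y⟩
    exact congrArg (Quotient.mk c.toSetoid) (ldiv_mul x y)
  rdiv_mul := by
    rintro ⟨x⟩ ⟨y⟩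
    exact congrArg (Quotient.mk c.toSetoid) (rdiv_mul x y)
  mul_rdiv := by
    rintro ⟨x⟩ ⟨y⟩
    exact congrArg (Quotient.mk c.toSetoid) (mul_rdiv x y)

/-- The quotient homomorphism. -/
def toQuot (c : LoopCon Q) : Q →* c.Quot where
  toFun := Quotient.mk c.toSetoid
  map_one' := rfl
  map_mul' _ _ := rfl

end LoopCon

/-! ### The Freese-McKenzie commutator of congruences -/

/-- Terms in the language of loops with variables from `X`. -/
inductive LoopTerm (X : Type) : Type
  | var : X → LoopTerm X
  | one : LoopTerm X
  | mul : LoopTerm X → LoopTerm X → LoopTerm X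
  | ldiv : LoopTerm X → LoopTerm X → LoopTerm X
  | div : LoopTerm X → LoopTerm X → LoopTerm X

/-- The value of a term in a loop under an assignment of the variables. -/
def LoopTerm.eval {X : Type} {Q : Type u} [Loop Q] (e : X → Q) : LoopTerm X → Q
  | .var i => e i
  | .one => 1
  | .mul s t => s.eval e * t.eval e
  | .ldiv s t => Loop.ldiv (s.eval e) (t.eval e)
  | .div s t => s.eval e / t.eval e

namespace LoopCon

variable {Q : Type u} [Loop Q]

/-- `C(α, β; δ)`: the congruence `α` centralizes `β` modulo `δ` (the term condition). -/
def Centralizes (α β δ : LoopCon Q) : Prop :=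
  ∀ (m n : ℕ) (t : LoopTerm (Fin m ⊕ Fin n)) (a b : Fin m → Q) (w z : Fin n → Q),
    (∀ i, α.r (a i) (b i)) → (∀ j, β.r (w j) (z j)) →
    δ.r (t.eval (Sum.elim a w)) (t.eval (Sum.elim a z)) →
    δ.r (t.eval (Sum.elim b w)) (t.eval (Sum.elim b z))

/-- The commutator `[α, β]` of two congruences: the smallest congruence `δ` such that
`α` centralizes `β` modulo `δ`, given as the intersection of all such `δ`. -/
def commutator (α β : LoopCon Q) : LoopCon Q where
  r x y := ∀ δ : LoopCon Q, Centralizes α β δ → δ.r x y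
  iseqv :=
    { refl := fun x δ _ => δ.iseqv.refl x
      symm := fun h δ hδ => δ.iseqv.symm (h δ hδ)
      trans := fun h k δ hδ => δ.iseqv.trans (h δ hδ) (k δ hδ) }
  mul' h k δ hδ := δ.mul' (h δ hδ) (k δ hδ)
  ldiv' h k δ hδ := δ.ldiv' (h δ hδ) (k δ hδ)
  div' h k δ hδ := δ.div' (h δ hδ) (k δ hδ)

/-- The intersection defining `[α, β]` itself satisfies the term condition, so it is indeed
the smallest congruence with this property. -/
theorem centralizes_commutator (α β : LoopCon Q) : Centralizes α β (commutator α β) :=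
  fun m n t a b w z hab hwz h δ hδ => hδ m n t a b w z hab hwz (h δ hδ)

end LoopCon

/-! ### Subloops, normal subloops, abelian normal subloops -/

/-- A subloop: a subset containing `1` and closed under `*`, `\` and `/`. -/
@[ext]
structure Subloop (Q : Type u) [Loop Q] where
  carrier : Set Q
  one_mem : (1 : Q) ∈ carrier
  mul_mem : ∀ {x y : Q}, x ∈ carrier → y ∈ carrier → x * y ∈ carrier
  ldiv_mem : ∀ {x y : Q}, x ∈ carrier → y ∈ carrier → ldiv x y ∈ carrier
  div_mem : ∀ {x y : Q}, x ∈ carrier → y ∈ carrier → x / y ∈ carrier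

namespace Subloop

variable {Q : Type u} [Loop Q]

instance : LE (Subloop Q) where
  le A B := A.carrier ⊆ B.carrier

instance : Top (Subloop Q) where
  top := ⟨Set.univ, trivial, fun _ _ => trivial, fun _ _ => trivial, fun _ _ => trivial⟩

instance : Bot (Subloop Q) where
  bot :=
    { carrier := {1}
      one_mem := rfl
      mul_mem := by
        rintro _ _ rfl rfl
        exact one_mul 1
      ldiv_mem := by
        rintro _ _ rfl rfl
        have := ldiv_mul (1 : Q) 1
        rwa [one_mul] at this
      div_mem := by
        rintro _ _ rfl rfl
        exact rdiv_eq_one.2 rfl }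

/-- The image of a subloop under a homomorphism of loops. -/
def map {L : Type v} [Loop L] (f : Q →* L) (A : Subloop Q) : Subloop L where
  carrier := f '' A.carrier
  one_mem := ⟨1, A.one_mem, map_one f⟩
  mul_mem := by
    rintro _ _ ⟨x, hx, rfl⟩ ⟨y, hy, rfl⟩
    exact ⟨x * y, A.mul_mem hx hy, map_mul f x y⟩
  ldiv_mem := by
    rintro _ _ ⟨x, hx, rfl⟩ ⟨y, hy, rfl⟩
    exact ⟨ldiv x y, A.ldiv_mem hx hy, map_ldiv f x y⟩
  div_mem := by
    rintro _ _ ⟨x, hx, rfl⟩ ⟨y, hy, rfl⟩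
    exact ⟨x / y, A.div_mem hx hy, map_rdiv f x y⟩

/-- A subloop is normal if it is the kernel of a homomorphism of loops. -/
def Normal (A : Subloop Q) : Prop :=
  ∃ (L : Type u) (_ : Loop L) (f : Q →* L), ∀ x, x ∈ A.carrier ↔ f x = 1

/-- The congruence `x / y ∈ A` of a normal subloop `A`. -/
def con (A : Subloop Q) (hA : A.Normal) : LoopCon Q :=
  have key : ∃ (L : Type u) (_ : Loop L) (f : Q →* L),
      ∀ x y, x / y ∈ A.carrier ↔ f x = f y := by
    obtain ⟨L, hL, f, hf⟩ := hA
    refine ⟨L, hL, f, fun x y => ?_⟩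
    rw [hf, map_rdiv, rdiv_eq_one]
  { r := fun x y => x / y ∈ A.carrier
    iseqv := by
      obtain ⟨L, hL, f, hf⟩ := key
      simp only [hf]
      exact ⟨fun _ => rfl, fun h => h.symm, fun h k => h.trans k⟩
    mul' := by
      obtain ⟨L, hL, f, hf⟩ := key
      intro w x y z h k
      rw [hf] at h k ⊢
      rw [map_mul, map_mul, h, k]
    ldiv' := by
      obtain ⟨L, hL, f, hf⟩ := key
      intro w x y z h k
      rw [hf] at h k ⊢
      rw [map_ldiv, map_ldiv, h, k]
    div' := by
      obtain ⟨L, hL, f, hf⟩ := key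
      intro w x y z h k
      rw [hf] at h k ⊢
      rw [map_rdiv, map_rdiv, h, k] }

/-- The commutator `[A, B]_Q` of two normal subloops: the class of `1` modulo the commutator
of the corresponding congruences. -/
def commutator (A B : Subloop Q) (hA : A.Normal) (hB : B.Normal) : Subloop Q :=
  let c := LoopCon.commutator (A.con hA) (B.con hB)
  { carrier := {x | c.r x 1}
    one_mem := c.iseqv.refl 1
    mul_mem := by
      intro x y hx hy
      have := c.mul' hx hy
      rwa [one_mul] at this
    ldiv_mem := by
      intro x y hx hy
      have h := c.ldiv' hx hy
      have e : ldiv (1 : Q) 1 = 1 := by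
        have := ldiv_mul (1 : Q) 1
        rwa [one_mul] at this
      rwa [e] at h
    div_mem := by
      intro x y hx hy
      have h := c.div' hx hy
      rwa [rdiv_eq_one.2 rfl] at h }

/-- A subloop `A` of `Q` is normal and abelian in `Q`, that is, `[A, A]_Q = 1`. -/
def IsAbelianIn (A : Subloop Q) : Prop :=
  ∃ hA : A.Normal, A.commutator A hA hA = ⊥

end Subloop

/-- A loop `Q` is congruence solvable if there is a series `1 = A₀ ≤ A₁ ≤ ⋯ ≤ Aₙ = Q` of normal
subloops of `Q` such that every factor `Aᵢ₊₁ / Aᵢ` is abelian in `Q / Aᵢ`. -/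
def IsCongruenceSolvable (Q : Type u) [Loop Q] : Prop :=
  ∃ (n : ℕ) (A : Fin (n + 1) → Subloop Q) (hA : ∀ i, (A i).Normal),
    A 0 = ⊥ ∧ A (Fin.last n) = ⊤ ∧
    ∀ i : Fin n, A i.castSucc ≤ A i.succ ∧
      ((A i.succ).map ((A i.castSucc).con (hA i.castSucc)).toQuot).IsAbelianIn

/-! ### Abelian extensions -/

/-- A loop cocycle `Γ = (φ, ψ, θ)` for a commutative group `A` and a loop `F`. -/
structure LoopCocycle (A : Type u) [AddCommGroup A] (F : Type v) [Loop F] where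
  φ : F → F → AddAut A
  ψ : F → F → AddAut A
  θ : F → F → A
  φ_one : ∀ y a, φ y 1 a = a
  ψ_one : ∀ y a, ψ 1 y a = a
  θ_one_left : ∀ y, θ 1 y = 0
  θ_one_right : ∀ y, θ y 1 = 0

/-- The underlying set `A × F` of the abelian extension of `A` by `F` over `Γ`. -/
def AbelianExtension {A : Type u} [AddCommGroup A] {F : Type v} [Loop F]
    (_Γ : LoopCocycle A F) : Type (max u v) := A × F

/-- The abelian extension of `A` by `F` over `Γ` is the loop on `A × F` with
`(a, x) * (b, y) = (φ x y a + ψ x y b + θ x y, x * y)` and neutral element `(0, 1)`. -/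
instance {A : Type u} [AddCommGroup A] {F : Type v} [Loop F] (Γ : LoopCocycle A F) :
    Loop (AbelianExtension Γ) where
  one := ((0, 1) : A × F)
  mul p q := ((Γ.φ p.2 q.2 p.1 + Γ.ψ p.2 q.2 q.1 + Γ.θ p.2 q.2, p.2 * q.2) : A × F)
  ldiv p q :=
    (((Γ.ψ p.2 (ldiv p.2 q.2)).symm
      (q.1 - Γ.φ p.2 (ldiv p.2 q.2) p.1 - Γ.θ p.2 (ldiv p.2 q.2)), ldiv p.2 q.2) : A × F)
  div p q :=
    (((Γ.φ (p.2 / q.2) q.2).symm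
      (p.1 - Γ.ψ (p.2 / q.2) q.2 q.1 - Γ.θ (p.2 / q.2) q.2), p.2 / q.2) : A × F)
  one_mul := by
    rintro ⟨a, x⟩
    refine Prod.ext ?_ (one_mul x)
    change Γ.φ 1 x 0 + Γ.ψ 1 x a + Γ.θ 1 x = a
    rw [map_zero, Γ.ψ_one, Γ.θ_one_left, zero_add, add_zero]
  mul_one := by
    rintro ⟨a, x⟩
    refine Prod.ext ?_ (mul_one x)
    change Γ.φ x 1 a + Γ.ψ x 1 0 + Γ.θ x 1 = a
    rw [map_zero, Γ.φ_one, Γ.θ_one_right, add_zero, add_zero]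
  mul_ldiv := by
    rintro ⟨a, x⟩ ⟨b, y⟩
    refine Prod.ext ?_ (mul_ldiv x y)
    change Γ.φ x (ldiv x y) a + Γ.ψ x (ldiv x y) ((Γ.ψ x (ldiv x y)).symm
      (b - Γ.φ x (ldiv x y) a - Γ.θ x (ldiv x y))) + Γ.θ x (ldiv x y) = b
    rw [AddEquiv.apply_symm_apply]
    abel
  ldiv_mul := by
    rintro ⟨a, x⟩ ⟨b, y⟩
    refine Prod.ext ?_ (ldiv_mul x y)
    change (Γ.ψ x (ldiv x (x * y))).symm (Γ.φ x y a + Γ.ψ x y b + Γ.θ x y -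
      Γ.φ x (ldiv x (x * y)) a - Γ.θ x (ldiv x (x * y))) = b
    rw [ldiv_mul, AddEquiv.symm_apply_eq]
    abel
  rdiv_mul := by
    rintro ⟨a, x⟩ ⟨b, y⟩
    refine Prod.ext ?_ (rdiv_mul x y)
    change Γ.φ (y / x) x ((Γ.φ (y / x) x).symm (b - Γ.ψ (y / x) x a - Γ.θ (y / x) x)) +
      Γ.ψ (y / x) x a + Γ.θ (y / x) x = b
    rw [AddEquiv.apply_symm_apply]
    abel
  mul_rdiv := by
    rintro ⟨a, x⟩ ⟨b, y⟩
    refine Prod.ext ?_ (mul_rdiv x y)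
    change (Γ.φ (y * x / x) x).symm (Γ.φ y x b + Γ.ψ y x a + Γ.θ y x -
      Γ.ψ (y * x / x) x a - Γ.θ (y * x / x) x) = b
    rw [mul_rdiv, AddEquiv.symm_apply_eq]
    abel

/-- Iterated abelian extensions: commutative groups, and (up to isomorphism) abelian extensions
of a commutative group by an iterated abelian extension. -/
inductive IsIteratedAbelianExtension : (Q : Type u) → [Loop Q] → Prop
  | base (Q : Type u) [Loop Q] (hQ : IsAbelianGroup Q) : IsIteratedAbelianExtension Q
  | step (Q A F : Type u) [Loop Q] [AddCommGroup A] [Loop F] (Γ : LoopCocycle A F)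
      (e : Q ≃* AbelianExtension Γ) (hF : IsIteratedAbelianExtension F) :
      IsIteratedAbelianExtension Q

/-! ### Affine quasidirect products -/

/-- The loop `Q` is (isomorphic to) an affine quasidirect product of the commutative group `A`
and the loop `F`: a loop on the set `A × F` whose multiplication is the one of `F` in the second
coordinate and, over each pair `(x, y)` in `F × F`, an affine combination in the first one, with
automorphisms of `A` as coefficients. No normalization at the neutral element is demanded. -/
def IsAffineQuasidirectProduct (Q A F : Type u) [Loop Q] [AddCommGroup A] [Loop F] : Prop :=
  ∃ (e : Q ≃ A × F) (f g : F → F → AddAut A) (c : F → F → A), ∀ p q : Q,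
    e (p * q) =
      (f (e p).2 (e q).2 (e p).1 + g (e p).2 (e q).2 (e q).1 + c (e p).2 (e q).2,
        (e p).2 * (e q).2)

/-- Polyabelian loops: iterated affine quasidirect products of commutative groups. -/
inductive IsPolyabelian : (Q : Type u) → [Loop Q] → Prop
  | base (Q : Type u) [Loop Q] (hQ : IsAbelianGroup Q) : IsPolyabelian Q
  | step (Q A F : Type u) [Loop Q] [AddCommGroup A] [Loop F]
      (h : IsAffineQuasidirectProduct Q A F) (hF : IsPolyabelian F) : IsPolyabelian Q

end LoopTheory

namespace LoopTheory

open Loop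

/-! ### Terms and homomorphisms -/

/-! The implications run in a cycle: congruence solvable, iterated abelian extension, polyabelian,
congruence solvable. The common language is `HasAbelianKernel f`: the kernel congruence of `f`
satisfies the term condition modulo equality. For normal `N ≤ M`, the factor `M / N` is abelian in
`Q / N` exactly when `Q / N → Q / M` has this property.

For a surjection `L → F` with abelian kernel, the term condition forces two polynomials in two
kernel variables to agree once they agree on both axes (`eval_eq`). So the kernel is a commutative
group, `u ↦ (u c d) / (c d)` and `u ↦ (c (u d)) / (c d)` are automorphisms of it, and `(u c)(v d)`
splits accordingly. A section with `s 1 = 1` then presents `L` as an abelian extension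
(`exists_cocycle`); descending a series of `Q` from the trivial quotient reaches `Q` itself.

An abelian extension is an affine quasidirect product by its very formula. In such a product every
term, over fixed second coordinates, is affine in the first ones (`eval_affine`). Hence `t(a, w) -
t(a, z)` does not depend on `a` within a class, so the projection to `F` has abelian kernel, and a
series of `F` pulls back to one of `Q`. -/

theorem rdiv_self {Q : Type u} [Loop Q] (x : Q) : x / x = 1 :=
  rdiv_eq_one.2 rfl

theorem ldiv_self {Q : Type u} [Loop Q] (x : Q) : ldiv x x = 1 :=
  eq_of_mul_left_eq (x := x) (by rw [mul_ldiv, mul_one])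

theorem LoopTerm.map_eval {X : Type} {Q : Type u} {L : Type v} [Loop Q] [Loop L] (f : Q →* L)
    (e : X → Q) (t : LoopTerm X) : f (t.eval e) = t.eval (f ∘ e) := by
  induction t with
  | var i => rfl
  | one => exact map_one f
  | mul s t hs ht => simp only [LoopTerm.eval, map_mul, hs, ht]
  | ldiv s t hs ht => simp only [LoopTerm.eval, map_ldiv, hs, ht]
  | div s t hs ht => simp only [LoopTerm.eval, map_rdiv, hs, ht]

instance (X : Type) : Mul (LoopTerm X) := ⟨LoopTerm.mul⟩

instance (X : Type) : Div (LoopTerm X) := ⟨LoopTerm.div⟩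

theorem LoopTerm.eval_div {X : Type} {Q : Type u} [Loop Q] (e : X → Q) (s t : LoopTerm X) :
    (s / t).eval e = s.eval e / t.eval e := rfl

/-- Multiplicative maps between loops preserve the neutral element. -/
def homOfMul {Q : Type u} {L : Type v} [Loop Q] [Loop L] (f : Q → L)
    (h : ∀ x y, f (x * y) = f x * f y) : Q →* L where
  toFun := f
  map_one' := eq_of_mul_left_eq (x := f 1) (by rw [← h, one_mul, mul_one])
  map_mul' := h

/-- The kernel congruence of `f` is abelian: it centralizes itself modulo equality. -/
def HasAbelianKernel {Q : Type u} {L : Type v} [Loop Q] [Loop L] (f : Q →* L) : Prop :=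
  ∀ (m n : ℕ) (t : LoopTerm (Fin m ⊕ Fin n)) (a b : Fin m → Q) (w z : Fin n → Q),
    (∀ i, f (a i) = f (b i)) → (∀ j, f (w j) = f (z j)) →
    t.eval (Sum.elim a w) = t.eval (Sum.elim a z) →
    t.eval (Sum.elim b w) = t.eval (Sum.elim b z)

theorem con_iff {Q L : Type u} [Loop Q] [Loop L] {f : Q →* L} {K : Subloop Q}
    (hf : ∀ x, x ∈ K.carrier ↔ f x = 1) (hK : K.Normal) {x y : Q} :
    (K.con hK).r x y ↔ f x = f y := by
  change x / y ∈ K.carrier ↔ _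
  rw [hf, map_rdiv, rdiv_eq_one]

/-- The equality congruence. -/
def eqCon (Q : Type u) [Loop Q] : LoopCon Q where
  r x y := x = y
  iseqv := ⟨fun _ => rfl, Eq.symm, Eq.trans⟩
  mul' h k := by rw [h, k]
  ldiv' h k := by rw [h, k]
  div' h k := by rw [h, k]

/-- Equality is the least congruence, so it centralizes exactly when the commutator is trivial; and
a congruence whose class of `1` is trivial is equality, since `x ~ y` gives `x / y ~ 1`. -/
theorem isAbelianIn_iff_hasAbelianKernel {Q L : Type u} [Loop Q] [Loop L] {f : Q →* L}
    {K : Subloop Q} (hf : ∀ x, x ∈ K.carrier ↔ f x = 1) :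
    K.IsAbelianIn ↔ HasAbelianKernel f := by
  constructor
  · rintro ⟨hK, h⟩ m n t a b w z hab hwz heq
    have triv : ∀ x y, (LoopCon.commutator (K.con hK) (K.con hK)).r x y → x = y := by
      intro x y hxy
      have h1 := LoopCon.div' _ hxy ((LoopCon.commutator (K.con hK) (K.con hK)).iseqv.refl y)
      rw [rdiv_self] at h1
      have h2 : x / y ∈ (K.commutator K hK hK).carrier := h1
      rw [h] at h2
      exact rdiv_eq_one.1 h2
    apply triv
    apply LoopCon.centralizes_commutator (K.con hK) (K.con hK) m n t a b w z
      (fun i => (con_iff hf hK).2 (hab i)) (fun j => (con_iff hf hK).2 (hwz j))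
    rw [heq]
  · intro h
    have hK : K.Normal := ⟨L, inferInstance, f, hf⟩
    refine ⟨hK, ?_⟩
    have hc : LoopCon.Centralizes (K.con hK) (K.con hK) (eqCon Q) := by
      intro m n t a b w z hab hwz heq
      exact h m n t a b w z (fun i => (con_iff hf hK).1 (hab i))
        (fun j => (con_iff hf hK).1 (hwz j)) heq
    apply Subloop.ext
    ext x
    constructor
    · intro hx
      exact hx (eqCon Q) hc
    · rintro rfl
      exact (K.commutator K hK hK).one_mem

/-! ### Factors of a normal series -/

section Factor

variable {Q : Type u} [Loop Q]

theorem mem_iff_con_one {M : Subloop Q} (hM : M.Normal) {x : Q} :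
    x ∈ M.carrier ↔ (M.con hM).toQuot x = 1 := by
  have e : x / 1 = x := by
    have := rdiv_mul (1 : Q) x
    rwa [mul_one] at this
  constructor
  · intro h
    refine Quotient.sound (s := (M.con hM).toSetoid) ?_
    change x / 1 ∈ M.carrier
    rwa [e]
  · intro h
    have h' : x / 1 ∈ M.carrier := Quotient.exact (s := (M.con hM).toSetoid) h
    rwa [e] at h'

/-- The natural map `Q / N → Q / M` for normal subloops `N ≤ M`. -/
def factorMap {N M : Subloop Q} (hN : N.Normal) (hM : M.Normal) (h : N ≤ M) :
    (N.con hN).Quot →* (M.con hM).Quot where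
  toFun := Quotient.map id fun _ _ hxy => h hxy
  map_one' := rfl
  map_mul' := by
    rintro ⟨x⟩ ⟨y⟩
    rfl

theorem factorMap_toQuot {N M : Subloop Q} (hN : N.Normal) (hM : M.Normal) (h : N ≤ M) (x : Q) :
    factorMap hN hM h ((N.con hN).toQuot x) = (M.con hM).toQuot x := rfl

theorem toQuot_surjective (c : LoopCon Q) : Function.Surjective c.toQuot := Quotient.mk_surjective

theorem toQuot_eq_iff (c : LoopCon Q) {x y : Q} : c.toQuot x = c.toQuot y ↔ c.r x y :=
  ⟨fun h => Quotient.exact (s := c.toSetoid) h, fun h => Quotient.sound (s := c.toSetoid) h⟩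

theorem factorMap_surjective {N M : Subloop Q} (hN : N.Normal) (hM : M.Normal) (h : N ≤ M) :
    Function.Surjective (factorMap hN hM h) := fun y => by
  obtain ⟨x, rfl⟩ := toQuot_surjective _ y
  exact ⟨_, factorMap_toQuot hN hM h x⟩

/-- Exhibits `M / N` as the kernel of `Q / N → Q / M`, so that the kernel criterion applies to
factors of a series. -/
theorem mem_map_iff_factorMap {N M : Subloop Q} (hN : N.Normal) (hM : M.Normal) (h : N ≤ M)
    (x : (N.con hN).Quot) :
    x ∈ (M.map (N.con hN).toQuot).carrier ↔ factorMap hN hM h x = 1 := by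
  obtain ⟨y, rfl⟩ := toQuot_surjective _ x
  rw [factorMap_toQuot, ← mem_iff_con_one hM]
  constructor
  · rintro ⟨w, hw, hwy⟩
    rw [mem_iff_con_one hM] at hw ⊢
    rw [← hw, ← factorMap_toQuot hN hM h, ← factorMap_toQuot hN hM h, hwy]
  · exact fun hy => ⟨y, hy, rfl⟩

/-- Tuples in `Q / N` lift to `Q`, and terms commute with the projection, so the term condition can
be checked on representatives. -/
theorem map_isAbelianIn_of_centralizes {N M : Subloop Q} (hN : N.Normal) (hM : M.Normal)
    (h : N ≤ M) (hc : LoopCon.Centralizes (M.con hM) (M.con hM) (N.con hN)) :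
    (M.map (N.con hN).toQuot).IsAbelianIn := by
  rw [isAbelianIn_iff_hasAbelianKernel (mem_map_iff_factorMap hN hM h)]
  intro m n t a b w z hab hwz heq
  have lift : ∀ {k : ℕ} (a : Fin k → (N.con hN).Quot), ∃ a' : Fin k → Q,
      (N.con hN).toQuot ∘ a' = a := fun a =>
    ⟨fun i => (toQuot_surjective _ (a i)).choose,
      funext fun i => (toQuot_surjective _ (a i)).choose_spec⟩
  obtain ⟨a, rfl⟩ := lift a
  obtain ⟨b, rfl⟩ := lift b
  obtain ⟨w, rfl⟩ := lift w
  obtain ⟨z, rfl⟩ := lift z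
  simp only [← Sum.comp_elim, ← LoopTerm.map_eval, toQuot_eq_iff] at heq ⊢
  exact hc m n t a b w z (fun i => (toQuot_eq_iff _).1 (hab i))
    (fun j => (toQuot_eq_iff _).1 (hwz j)) heq

end Factor

/-! ### Commutative groups -/

/-- The additive group structure of a loop that is a commutative group. -/
abbrev IsAbelianGroup.addCommGroup {Q : Type u} [Loop Q] (h : IsAbelianGroup Q) :
    AddCommGroup Q :=
  letI : Add Q := ⟨fun x y => x * y⟩
  letI : Zero Q := ⟨1⟩
  letI : Neg Q := ⟨fun x => 1 / x⟩
  { add_assoc := h.1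
    zero_add := one_mul
    add_zero := mul_one
    add_comm := h.2
    neg_add_cancel := fun x => rdiv_mul x 1
    nsmul := nsmulRec
    zsmul := zsmulRec }

/-! ### Loops with an abelian kernel are abelian extensions -/

section Extension

variable {L F : Type u} [Loop L] [Loop F] {f : L →* F}

/-- Two polynomials in two variables that agree on both axes agree on an abelian kernel. -/
theorem HasAbelianKernel.eval_eq (hf : HasAbelianKernel f) {k : ℕ} (c : Fin k → L)
    (s t : LoopTerm (Fin (k + 1) ⊕ Fin 1))
    (hu : ∀ u, f u = 1 → s.eval (Sum.elim (Matrix.vecCons u c) ![1]) =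
      t.eval (Sum.elim (Matrix.vecCons u c) ![1]))
    (hv : ∀ v, f v = 1 → s.eval (Sum.elim (Matrix.vecCons 1 c) ![v]) =
      t.eval (Sum.elim (Matrix.vecCons 1 c) ![v]))
    {u v : L} (u1 : f u = 1) (v1 : f v = 1) :
    s.eval (Sum.elim (Matrix.vecCons u c) ![v]) =
      t.eval (Sum.elim (Matrix.vecCons u c) ![v]) := by
  -- Term condition for `s / t`: its values at `(1, 1)` and `(1, v)` are both `1`, so its values at
  -- `(u, 1)` and `(u, v)` coincide, and the former is `1`.
  have h := hf (k + 1) 1 (s / t) (Matrix.vecCons 1 c) (Matrix.vecCons u c) ![1] ![v]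
    (by
      intro i
      refine Fin.cases ?_ (fun i => ?_) i
      · simp [u1]
      · simp)
    (by
      intro i
      simp [Subsingleton.elim i 0, v1])
  simp only [LoopTerm.eval_div] at h
  rw [hu u u1, hu 1 (map_one f), hv v v1, rdiv_self, rdiv_self, rdiv_self] at h
  exact rdiv_eq_one.1 (h rfl).symm

/-- The first variable ranging over the kernel. -/
abbrev varU {k : ℕ} : LoopTerm (Fin (k + 1) ⊕ Fin 1) := .var (.inl 0)

/-- The second variable ranging over the kernel. -/
abbrev varV {k : ℕ} : LoopTerm (Fin (k + 1) ⊕ Fin 1) := .var (.inr 0)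

/-- The parameters. -/
abbrev par {k : ℕ} (i : Fin k) : LoopTerm (Fin (k + 1) ⊕ Fin 1) := .var (.inl i.succ)

theorem HasAbelianKernel.mul_comm (hf : HasAbelianKernel f) {u v : L} (hu : f u = 1)
    (hv : f v = 1) : u * v = v * u := by
  have h := hf.eval_eq ![] (varU * varV) (varV * varU) (by simp [LoopTerm.eval])
      (by simp [LoopTerm.eval]) hu hv
  simpa [LoopTerm.eval] using h

/-- Here `c` ranges over all of `L`, which allows regrouping against values of a section and not
only inside the kernel. -/
theorem HasAbelianKernel.mul_assoc (hf : HasAbelianKernel f) {u v : L} (hu : f u = 1)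
    (hv : f v = 1) (c : L) : u * v * c = u * (v * c) := by
  have h := hf.eval_eq ![c] (varU * varV * par 0) (varU * (varV * par 0))
      (by simp [LoopTerm.eval]) (by simp [LoopTerm.eval]) hu hv
  simpa [LoopTerm.eval] using h

/-- Additivity of the automorphism `φ` of the cocycle; on either axis one factor becomes `1`. -/
theorem HasAbelianKernel.left_mul (hf : HasAbelianKernel f) {u v : L} (hu : f u = 1)
    (hv : f v = 1) (c d : L) :
    (u * v * c * d) / (c * d) = ((u * c * d) / (c * d)) * ((v * c * d) / (c * d)) := by
  have h := hf.eval_eq ![c, d] ((varU * varV * par 0 * par 1) / (par 0 * par 1))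
      (((varU * par 0 * par 1) / (par 0 * par 1)) * ((varV * par 0 * par 1) / (par 0 * par 1)))
      (by simp [LoopTerm.eval_div, LoopTerm.eval, rdiv_self])
      (by simp [LoopTerm.eval_div, LoopTerm.eval, rdiv_self]) hu hv
  simpa [LoopTerm.eval_div, LoopTerm.eval] using h

theorem HasAbelianKernel.right_mul (hf : HasAbelianKernel f) {u v : L} (hu : f u = 1)
    (hv : f v = 1) (c d : L) :
    (c * (u * v * d)) / (c * d) = ((c * (u * d)) / (c * d)) * ((c * (v * d)) / (c * d)) := by
  have h := hf.eval_eq ![c, d] ((par 0 * (varU * varV * par 1)) / (par 0 * par 1))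
      (((par 0 * (varU * par 1)) / (par 0 * par 1)) *
        ((par 0 * (varV * par 1)) / (par 0 * par 1)))
      (by simp [LoopTerm.eval_div, LoopTerm.eval, rdiv_self])
      (by simp [LoopTerm.eval_div, LoopTerm.eval, rdiv_self]) hu hv
  simpa [LoopTerm.eval_div, LoopTerm.eval] using h

/-- Source of the multiplication formula of the extension. The brackets are placed so that on each
axis one quotient is `1` and the other cancels against `c * d`. -/
theorem HasAbelianKernel.mul_mul_mul (hf : HasAbelianKernel f) {u v : L} (hu : f u = 1)
    (hv : f v = 1) (c d : L) :
    u * c * (v * d) = ((u * c * d) / (c * d)) * (((c * (v * d)) / (c * d)) * (c * d)) := by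
  have h := hf.eval_eq ![c, d] (varU * par 0 * (varV * par 1))
      (((varU * par 0 * par 1) / (par 0 * par 1)) *
        (((par 0 * (varV * par 1)) / (par 0 * par 1)) * (par 0 * par 1)))
      (by simp [LoopTerm.eval_div, LoopTerm.eval, rdiv_self, rdiv_mul])
      (by simp [LoopTerm.eval_div, LoopTerm.eval, rdiv_self, rdiv_mul]) hu hv
  simpa [LoopTerm.eval_div, LoopTerm.eval] using h

/-- The underlying type of the kernel. -/
abbrev Ker (f : L →* F) : Type u := {x : L // f x = 1}

instance (f : L →* F) : Loop (Ker f) where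
  one := ⟨1, map_one f⟩
  mul x y := ⟨x.1 * y.1, by rw [map_mul, x.2, y.2, one_mul]⟩
  div x y := ⟨x.1 / y.1, by rw [map_rdiv, x.2, y.2, rdiv_self]⟩
  ldiv x y := ⟨ldiv x.1 y.1, by rw [map_ldiv, x.2, y.2, ldiv_self]⟩
  one_mul x := Subtype.ext (one_mul x.1)
  mul_one x := Subtype.ext (mul_one x.1)
  mul_ldiv x y := Subtype.ext (mul_ldiv x.1 y.1)
  ldiv_mul x y := Subtype.ext (ldiv_mul x.1 y.1)
  rdiv_mul x y := Subtype.ext (rdiv_mul x.1 y.1)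
  mul_rdiv x y := Subtype.ext (mul_rdiv x.1 y.1)

theorem HasAbelianKernel.isAbelianGroup (hf : HasAbelianKernel f) : IsAbelianGroup (Ker f) :=
  ⟨fun x y z => Subtype.ext (hf.mul_assoc x.2 y.2 z.1),
    fun x y => Subtype.ext (hf.mul_comm x.2 y.2)⟩

/-- An abelian kernel as an additive group. -/
abbrev HasAbelianKernel.addCommGroup (hf : HasAbelianKernel f) : AddCommGroup (Ker f) :=
  hf.isAbelianGroup.addCommGroup

/-- The action of `c, d` on an abelian kernel from the left factor. -/
def HasAbelianKernel.leftAut (hf : HasAbelianKernel f) (c d : L) :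
    letI := hf.addCommGroup
    AddAut (Ker f) :=
  letI := hf.addCommGroup
  { toFun := fun u => ⟨(u.1 * c * d) / (c * d), by
      simp only [map_rdiv, map_mul, u.2, one_mul, rdiv_self]⟩
    invFun := fun u => ⟨((u.1 * (c * d)) / d) / c, by
      simp only [map_rdiv, map_mul, u.2, one_mul, mul_rdiv, rdiv_self]⟩
    left_inv := fun u => Subtype.ext (by simp only [rdiv_mul, mul_rdiv])
    right_inv := fun u => Subtype.ext (by simp only [rdiv_mul, mul_rdiv])
    map_add' := fun u v => Subtype.ext (hf.left_mul u.2 v.2 c d) }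

/-- The action of `c, d` on an abelian kernel from the right factor. -/
def HasAbelianKernel.rightAut (hf : HasAbelianKernel f) (c d : L) :
    letI := hf.addCommGroup
    AddAut (Ker f) :=
  letI := hf.addCommGroup
  { toFun := fun u => ⟨(c * (u.1 * d)) / (c * d), by
      simp only [map_rdiv, map_mul, u.2, one_mul, rdiv_self]⟩
    invFun := fun u => ⟨(ldiv c (u.1 * (c * d))) / d, by
      simp only [map_rdiv, map_ldiv, map_mul, u.2, one_mul, ldiv_mul, rdiv_self]⟩
    left_inv := fun u => Subtype.ext (by simp only [rdiv_mul, ldiv_mul, mul_rdiv])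
    right_inv := fun u => Subtype.ext (by simp only [rdiv_mul, mul_ldiv, mul_rdiv])
    map_add' := fun u v => Subtype.ext (hf.right_mul u.2 v.2 c d) }

/-- The cocycle of a loop with an abelian kernel, given a normalized section. -/
def HasAbelianKernel.cocycle (hf : HasAbelianKernel f) (s : F → L) (hs : ∀ x, f (s x) = x)
    (s1 : s 1 = 1) :
    letI := hf.addCommGroup
    LoopCocycle (Ker f) F :=
  letI := hf.addCommGroup
  { φ := fun x y => hf.leftAut (s x) (s y)
    ψ := fun x y => hf.rightAut (s x) (s y)
    -- The failure of the section to be a homomorphism.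
    θ := fun x y => ⟨(s x * s y) / s (x * y), by rw [map_rdiv, map_mul, hs, hs, hs, rdiv_self]⟩
    φ_one := fun y a => Subtype.ext (by
      change (a.1 * s y * s 1) / (s y * s 1) = a.1
      rw [s1, mul_one, mul_one, mul_rdiv])
    ψ_one := fun y a => Subtype.ext (by
      change (s 1 * (a.1 * s y)) / (s 1 * s y) = a.1
      rw [s1, one_mul, one_mul, mul_rdiv])
    θ_one_left := fun y => Subtype.ext (by
      change (s 1 * s y) / s (1 * y) = 1
      rw [s1, one_mul, one_mul, rdiv_self])
    θ_one_right := fun y => Subtype.ext (by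
      change (s y * s 1) / s (y * 1) = 1
      rw [s1, mul_one, mul_one, rdiv_self]) }

/-- Every element of `L` is uniquely `a * s x` with `a` in the kernel, so `(a, x) ↦ a * s x` is the
isomorphism. -/
theorem HasAbelianKernel.exists_cocycle (hf : HasAbelianKernel f) (hsurj : Function.Surjective f) :
    ∃ (A : Type u) (_ : AddCommGroup A) (Γ : LoopCocycle A F),
      Nonempty (L ≃* AbelianExtension Γ) := by
  classical
  obtain ⟨s, hs, s1⟩ : ∃ s : F → L, (∀ x, f (s x) = x) ∧ s 1 = 1 := by
    -- An arbitrary section is corrected at `1`, as the cocycle normalizations require.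
    refine ⟨Function.update (Function.surjInv hsurj) 1 1, fun x => ?_, Function.update_self ..⟩
    by_cases hx : x = 1
    · subst hx
      rw [Function.update_self, map_one]
    · rw [Function.update_of_ne hx, Function.surjInv_eq hsurj]
  let _ := hf.addCommGroup
  refine ⟨Ker f, hf.addCommGroup, hf.cocycle s hs s1, ⟨MulEquiv.symm ?_⟩⟩
  refine
    { toFun := fun p => p.1.1 * s p.2
      invFun := fun p => (⟨p / s (f p), by rw [map_rdiv, hs, rdiv_self]⟩, f p)
      left_inv := ?_
      right_inv := fun p => rdiv_mul _ _
      map_mul' := ?_ }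
  · rintro ⟨a, x⟩
    have hx : f (a.1 * s x) = x := by rw [map_mul, a.2, hs, one_mul]
    refine Prod.ext (Subtype.ext ?_) hx
    change a.1 * s x / s (f (a.1 * s x)) = a.1
    rw [hx, mul_rdiv]
  · rintro ⟨a, x⟩ ⟨b, y⟩
    change ((a.1 * s x * s y) / (s x * s y) * ((s x * (b.1 * s y)) / (s x * s y)) *
      ((s x * s y) / s (x * y))) * s (x * y) = a.1 * s x * (b.1 * s y)
    have h1 := (hf.leftAut (s x) (s y) a).2
    have h2 := (hf.rightAut (s x) (s y) b).2
    have h3 := ((hf.cocycle s hs s1).θ x y).2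
    have h12 := ((hf.leftAut (s x) (s y) a) * (hf.rightAut (s x) (s y) b)).2
    -- Regrouping turns the last two factors into `s x * s y`; a second regrouping reaches the right
    -- side of `mul_mul_mul`.
    exact (hf.mul_assoc h12 h3 _).trans <| (congrArg _ (rdiv_mul _ _)).trans <|
      (hf.mul_assoc h1 h2 _).trans (hf.mul_mul_mul a.2 b.2 _ _).symm

end Extension

/-! ### Congruence solvable loops are iterated abelian extensions -/

theorem IsAbelianGroup.congr {Q R : Type u} [Loop Q] [Loop R] (e : R ≃* Q)
    (h : IsAbelianGroup Q) : IsAbelianGroup R :=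
  ⟨fun x y z => e.injective (by simp only [map_mul, h.1]),
    fun x y => e.injective (by simp only [map_mul, h.2 (e x)])⟩

/-- Needed because the descent ends at `Q / A 0`, which is only isomorphic to `Q`. -/
theorem IsIteratedAbelianExtension.congr {Q R : Type u} [Loop Q] [Loop R] (e : R ≃* Q)
    (h : IsIteratedAbelianExtension Q) : IsIteratedAbelianExtension R := by
  cases h with
  | base _ hQ => exact .base R (hQ.congr e)
  | step _ A F Γ e' hF => exact .step R A F Γ (e.trans e') hF

theorem IsCongruenceSolvable.isIteratedAbelianExtension {Q : Type u} [Loop Q]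
    (h : IsCongruenceSolvable Q) : IsIteratedAbelianExtension Q := by
  obtain ⟨n, A, hA, h0, hn, hstep⟩ := h
  have key : ∀ i, IsIteratedAbelianExtension ((A i).con (hA i)).Quot := by
    intro i
    -- Downward: `Q / A n` is trivial, and `Q / A i` is an abelian extension by `Q / A (i + 1)`.
    induction i using Fin.reverseInduction with
    | last =>
      have triv : ∀ x : ((A (Fin.last n)).con (hA (Fin.last n))).Quot, x = 1 := by
        intro x
        obtain ⟨y, rfl⟩ := toQuot_surjective _ x
        rw [← mem_iff_con_one, hn]
        trivial
      exact .base _ ⟨fun x y z => (triv _).trans (triv _).symm,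
        fun x y => (triv _).trans (triv _).symm⟩
    | cast i ih =>
      obtain ⟨hle, hab⟩ := hstep i
      rw [isAbelianIn_iff_hasAbelianKernel
        (mem_map_iff_factorMap (hA i.castSucc) (hA i.succ) hle)] at hab
      obtain ⟨B, _, Γ, ⟨e⟩⟩ := hab.exists_cocycle (factorMap_surjective _ _ hle)
      exact .step _ B _ Γ e ih
  refine (key 0).congr (MulEquiv.ofBijective ((A 0).con (hA 0)).toQuot
    ⟨fun x y hxy => ?_, toQuot_surjective _⟩)
  have hxy' : x / y ∈ (A 0).carrier := (toQuot_eq_iff _).1 hxy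
  rw [h0] at hxy'
  exact rdiv_eq_one.1 hxy'

/-! ### Iterated abelian extensions are polyabelian -/

theorem IsIteratedAbelianExtension.isPolyabelian {Q : Type u} [Loop Q]
    (h : IsIteratedAbelianExtension Q) : IsPolyabelian Q := by
  induction h with
  | base Q hQ => exact .base Q hQ
  | step Q A F Γ e hF ih =>
    exact .step Q A F ⟨e.toEquiv, Γ.φ, Γ.ψ, Γ.θ, fun p q => map_mul e p q⟩ ih

/-! ### Polyabelian loops are congruence solvable -/

/-- Term operations of an affine quasidirect product are affine in the first coordinate. -/
theorem eval_affine {Q A F : Type u} [Loop Q] [AddCommGroup A] [Loop F] {e : Q ≃ A × F}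
    {f g : F → F → AddAut A} {c : F → F → A}
    (he : ∀ p q : Q, e (p * q) =
      (f (e p).2 (e q).2 (e p).1 + g (e p).2 (e q).2 (e q).1 + c (e p).2 (e q).2,
        (e p).2 * (e q).2)) {π : Q →* F} (hπ : ∀ p, π p = (e p).2)
    {X : Type} (t : LoopTerm X) (x : X → F) :
    ∃ (l : (X → A) →+ A) (d : A), ∀ w : X → Q, (∀ i, π (w i) = x i) →
      (e (t.eval w)).1 = l (fun i => (e (w i)).1) + d := by
  -- Second coordinates of all subterms depend only on `x`, so the coefficients met at each node are
  -- constants.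
  have hsnd : ∀ (s : LoopTerm X) (w : X → Q), (∀ i, π (w i) = x i) →
      (e (s.eval w)).2 = s.eval x := by
    intro s w hw
    rw [← hπ, LoopTerm.map_eval]
    congr 1
    exact funext hw
  induction t with
  | var i => exact ⟨Pi.evalAddMonoidHom _ i, 0, fun w _ => (add_zero _).symm⟩
  | one => exact ⟨0, (e 1).1, fun w _ => (zero_add _).symm⟩
  | mul s t hs ht =>
    obtain ⟨l, d, hl⟩ := hs
    obtain ⟨l', d', hl'⟩ := ht
    refine ⟨(f (s.eval x) (t.eval x)).toAddMonoidHom.comp l +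
      (g (s.eval x) (t.eval x)).toAddMonoidHom.comp l',
      f (s.eval x) (t.eval x) d + g (s.eval x) (t.eval x) d' + c (s.eval x) (t.eval x),
      fun w hw => ?_⟩
    have h := congrArg Prod.fst (he (s.eval w) (t.eval w))
    rw [hsnd s w hw, hsnd t w hw, hl w hw, hl' w hw] at h
    refine h.trans ?_
    simp only [map_add, AddMonoidHom.add_apply, AddMonoidHom.comp_apply,
      AddEquiv.coe_toAddMonoidHom]
    abel
  | ldiv s t hs ht =>
    obtain ⟨l, d, hl⟩ := hs
    obtain ⟨l', d', hl'⟩ := ht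
    set p := s.eval x with hp
    set q := (LoopTerm.ldiv s t).eval x with hq
    -- Only multiplication has a given formula; the quotient is found by solving `s * (s \ t) = t`
    -- for its first coordinate.
    refine ⟨(g p q).symm.toAddMonoidHom.comp (l' - (f p q).toAddMonoidHom.comp l),
      (g p q).symm (d' - f p q d - c p q), fun w hw => ?_⟩
    have h := congrArg Prod.fst (he (s.eval w) ((LoopTerm.ldiv s t).eval w))
    rw [hsnd s w hw, hsnd (LoopTerm.ldiv s t) w hw, hl w hw, ← hp, ← hq] at h
    have h' : s.eval w * (LoopTerm.ldiv s t).eval w = t.eval w := mul_ldiv _ _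
    rw [h', hl' w hw] at h
    simp only [AddMonoidHom.comp_apply, AddEquiv.coe_toAddMonoidHom]
    rw [← map_add, AddEquiv.eq_symm_apply]
    simp only [AddMonoidHom.sub_apply, AddMonoidHom.comp_apply, AddEquiv.coe_toAddMonoidHom]
    simp only [map_add] at h
    rw [← sub_eq_zero] at h ⊢
    rw [← neg_eq_zero, ← h]
    abel
  -- The dividend is called `t`, so that primed data belong to it as in the previous case.
  | div t s ht hs =>
    obtain ⟨l, d, hl⟩ := hs
    obtain ⟨l', d', hl'⟩ := ht
    set p := s.eval x with hp
    set q := (LoopTerm.div t s).eval x with hq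
    refine ⟨(f q p).symm.toAddMonoidHom.comp (l' - (g q p).toAddMonoidHom.comp l),
      (f q p).symm (d' - g q p d - c q p), fun w hw => ?_⟩
    have h := congrArg Prod.fst (he ((LoopTerm.div t s).eval w) (s.eval w))
    rw [hsnd s w hw, hsnd (LoopTerm.div t s) w hw, hl w hw, ← hp, ← hq] at h
    have h' : (LoopTerm.div t s).eval w * s.eval w = t.eval w := rdiv_mul _ _
    rw [h', hl' w hw] at h
    simp only [AddMonoidHom.comp_apply, AddEquiv.coe_toAddMonoidHom]
    rw [← map_add, AddEquiv.eq_symm_apply]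
    simp only [AddMonoidHom.sub_apply, AddMonoidHom.comp_apply, AddEquiv.coe_toAddMonoidHom]
    simp only [map_add] at h
    rw [← sub_eq_zero] at h ⊢
    rw [← neg_eq_zero, ← h]
    abel

theorem IsAffineQuasidirectProduct.exists_hom {Q A F : Type u} [Loop Q] [AddCommGroup A] [Loop F]
    (h : IsAffineQuasidirectProduct Q A F) :
    ∃ π : Q →* F, HasAbelianKernel π := by
  obtain ⟨e, f, g, c, he⟩ := h
  -- Without normalization `e 1` need not be `(0, 1)`, but multiplicativity already forces its
  -- second coordinate to be `1`.
  let π : Q →* F := homOfMul (fun p => (e p).2) fun p q => congrArg Prod.snd (he p q)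
  refine ⟨π, ?_⟩
  · intro m n t a b w z hab hwz heq
    obtain ⟨l, d, hl⟩ := eval_affine he (π := π) (fun _ => rfl) t (Sum.elim (π ∘ a) (π ∘ w))
    have hw : ∀ j, π (z j) = π (w j) := fun j => (hwz j).symm
    have hb : ∀ j, π (b j) = π (a j) := fun j => (hab j).symm
    have haw := hl (Sum.elim a w) (by rintro (i | i) <;> simp)
    have haz := hl (Sum.elim a z) (by rintro (i | i) <;> simp [hw])
    have hbw := hl (Sum.elim b w) (by rintro (i | i) <;> simp [hb])
    have hbz := hl (Sum.elim b z) (by rintro (i | i) <;> simp [hb, hw])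
    apply e.injective
    refine Prod.ext ?_ ?_
    · rw [heq, haz] at haw
      rw [hbw, hbz]
      have hsub := add_right_cancel haw
      rw [← sub_eq_zero, ← map_sub] at hsub
      -- Both differences of arguments vanish on the first block of variables and agree up to sign
      -- on the second; the constant `d` cancels.
      rw [add_left_inj, ← sub_eq_zero, ← map_sub, ← neg_eq_zero, ← map_neg, ← hsub]
      congr 1
      funext i
      rcases i with i | i <;> simp
    · change π (t.eval _) = π (t.eval _)
      rw [LoopTerm.map_eval, LoopTerm.map_eval]
      congr 1
      funext i
      rcases i with i | i <;> simp [hw]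

/-- The preimage of a subloop under a homomorphism of loops. -/
def Subloop.comap {Q L : Type u} [Loop Q] [Loop L] (f : Q →* L) (B : Subloop L) : Subloop Q where
  carrier := f ⁻¹' B.carrier
  one_mem := by
    rw [Set.mem_preimage, map_one]
    exact B.one_mem
  mul_mem hx hy := by
    rw [Set.mem_preimage, map_mul]
    exact B.mul_mem hx hy
  ldiv_mem hx hy := by
    rw [Set.mem_preimage, map_ldiv]
    exact B.ldiv_mem hx hy
  div_mem hx hy := by
    rw [Set.mem_preimage, map_rdiv]
    exact B.div_mem hx hy

theorem Subloop.comap_normal {Q L : Type u} [Loop Q] [Loop L] (f : Q →* L) {B : Subloop L}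
    (hB : B.Normal) : (B.comap f).Normal := by
  obtain ⟨M, hM, g, hg⟩ := hB
  exact ⟨M, hM, g.comp f, fun x => hg (f x)⟩

theorem Subloop.bot_normal (Q : Type u) [Loop Q] : (⊥ : Subloop Q).Normal :=
  ⟨Q, inferInstance, MonoidHom.id Q, fun _ => Iff.rfl⟩

/-- A factor of a normal series that is abelian in the quotient satisfies the term condition. -/
theorem centralizes_of_map_isAbelianIn {Q : Type u} [Loop Q] {N M : Subloop Q} (hN : N.Normal)
    (hM : M.Normal) (h : N ≤ M) (hab : (M.map (N.con hN).toQuot).IsAbelianIn) :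
    LoopCon.Centralizes (M.con hM) (M.con hM) (N.con hN) := by
  rw [isAbelianIn_iff_hasAbelianKernel (mem_map_iff_factorMap hN hM h)] at hab
  intro m n t a b w z hab' hwz heq
  have key := hab m n t ((N.con hN).toQuot ∘ a) ((N.con hN).toQuot ∘ b) ((N.con hN).toQuot ∘ w)
    ((N.con hN).toQuot ∘ z) (fun i => (toQuot_eq_iff (M.con hM)).2 (hab' i))
    (fun j => (toQuot_eq_iff (M.con hM)).2 (hwz j))
  simp only [← Sum.comp_elim, ← LoopTerm.map_eval, toQuot_eq_iff] at key
  exact key heq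

/-- The preimages of a series of `F`, with the trivial subloop prepended, form a series of `Q`: the
bottom factor is the kernel of `f`, and the congruences of the others are pulled back from `F`,
along with the term condition. Surjectivity of `f` plays no role. -/
theorem isCongruenceSolvable_of_hasAbelianKernel {Q F : Type u} [Loop Q] [Loop F] {f : Q →* F}
    (hf : HasAbelianKernel f) (hF : IsCongruenceSolvable F) : IsCongruenceSolvable Q := by
  obtain ⟨n, B, hB, h0, hn, hstep⟩ := hF
  let A : Fin (n + 2) → Subloop Q := Fin.cons ⊥ fun i => (B i).comap f
  have hA : ∀ i, (A i).Normal := by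
    intro i
    refine Fin.cases (Subloop.bot_normal Q) (fun i => Subloop.comap_normal f (hB i)) i
  refine ⟨n + 1, A, hA, rfl, ?_, ?_⟩
  · rw [← Fin.succ_last]
    change (B (Fin.last n)).comap f = ⊤
    rw [hn]
    rfl
  · intro i
    induction i using Fin.cases with
    | zero =>
      have hle : A 0 ≤ A 1 := by
        rintro _ rfl
        exact (A 1).one_mem
      have hker : ∀ x, x ∈ (A 1).carrier ↔ f x = 1 := by
        intro x
        change f x ∈ (B 0).carrier ↔ _
        rw [h0]
        rfl
      have hbot : ∀ x, x ∈ (A 0).carrier ↔ MonoidHom.id Q x = 1 := fun _ => Iff.rfl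
      refine ⟨hle, map_isAbelianIn_of_centralizes (hA 0) (hA 1) hle ?_⟩
      intro m n t a b w z hab hwz heq
      rw [con_iff hbot] at heq ⊢
      exact hf m n t a b w z (fun i => (con_iff hker (hA 1)).1 (hab i))
        (fun j => (con_iff hker (hA 1)).1 (hwz j)) heq
    | succ i =>
      obtain ⟨hle, hab⟩ := hstep i
      have hle' : A i.succ.castSucc ≤ A i.succ.succ := fun x hx => hle hx
      refine ⟨hle', map_isAbelianIn_of_centralizes (hA _) (hA _) hle' ?_⟩
      have hc := centralizes_of_map_isAbelianIn (hB _) (hB _) hle hab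
      have hcon : ∀ (j : Fin (n + 1)) (x y : Q), ((A j.succ).con (hA j.succ)).r x y ↔
          ((B j).con (hB j)).r (f x) (f y) := by
        intro j x y
        change f (x / y) ∈ (B j).carrier ↔ f x / f y ∈ (B j).carrier
        rw [map_rdiv]
      intro m n t a b w z hab' hwz heq
      have heq' := (hcon i.castSucc _ _).1 heq
      refine (hcon i.castSucc _ _).2 ?_
      rw [LoopTerm.map_eval, LoopTerm.map_eval, Sum.comp_elim, Sum.comp_elim] at heq' ⊢
      exact hc m n t (f ∘ a) (f ∘ b) (f ∘ w) (f ∘ z) (fun k => (hcon i.succ _ _).1 (hab' k))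
        (fun k => (hcon i.succ _ _).1 (hwz k)) heq'

/-- The trivial loop. -/
instance : Loop PUnit.{u + 1} where
  ldiv _ _ := PUnit.unit
  mul_ldiv _ _ := rfl
  ldiv_mul _ _ := rfl
  rdiv_mul _ _ := rfl
  mul_rdiv _ _ := rfl

theorem isCongruenceSolvable_punit : IsCongruenceSolvable PUnit.{u + 1} := by
  refine ⟨0, fun _ => ⊥, fun _ => Subloop.bot_normal _, rfl, ?_, fun i => i.elim0⟩
  apply Subloop.ext
  ext x
  exact ⟨fun _ => trivial, fun _ => rfl⟩

/-- Lets the base case of polyabelian loops be handled like the inductive step, over the trivial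
loop. -/
theorem IsAbelianGroup.isAffineQuasidirectProduct {Q : Type u} [Loop Q] (h : IsAbelianGroup Q) :
    letI := h.addCommGroup
    IsAffineQuasidirectProduct Q Q PUnit.{u + 1} := by
  let _ := h.addCommGroup
  refine ⟨(Equiv.prodPUnit Q).symm, fun _ _ => AddEquiv.refl Q, fun _ _ => AddEquiv.refl Q,
    fun _ _ => 0, fun p q => Prod.ext ?_ rfl⟩
  exact (add_zero (p + q)).symm

theorem IsPolyabelian.isCongruenceSolvable {Q : Type u} [Loop Q] (h : IsPolyabelian Q) :
    IsCongruenceSolvable Q := by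
  induction h with
  | base Q hQ =>
    let _ := hQ.addCommGroup
    obtain ⟨π, hπ⟩ := hQ.isAffineQuasidirectProduct.exists_hom
    exact isCongruenceSolvable_of_hasAbelianKernel hπ isCongruenceSolvable_punit
  | step Q A F h hF ih =>
    obtain ⟨π, hπ⟩ := h.exists_hom
    exact isCongruenceSolvable_of_hasAbelianKernel hπ ih

end LoopTheory

theorem corollary4p1 (Q : Type u) [LoopTheory.Loop Q] :
    (LoopTheory.IsCongruenceSolvable Q ↔ LoopTheory.IsIteratedAbelianExtension Q) ∧
      (LoopTheory.IsIteratedAbelianExtension Q ↔ LoopTheory.IsPolyabelian Q) :=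
  ⟨⟨fun h => h.isIteratedAbelianExtension, fun h => h.isPolyabelian.isCongruenceSolvable⟩,
    ⟨fun h => h.isPolyabelian, fun h => h.isCongruenceSolvable.isIteratedAbelianExtension⟩⟩
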